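/- **Definitions.** A *quasigroup* $(Q,\cdot,/,\backslash)$ is a set with three binary operations satisfying $x\cdot(x\backslash y)=y$, $(y/x)\cdot x=y$, $x\backslash(x\cdot y)=y$ and $(y\cdot x)/x=y$. A *pique* $(Q,\cdot,/,\backslash,e)$ is a quasigroup with a pointed element $e$ such that $e\cdot e=e$. It is *central* if the diagonal $\{(x,x)\mid x\in Q\}$ is a congruence class of some congruence on the direct square $Q\times Q$. Homomorphisms of piques preserve all the operations and $e$. Write $\mu$ for the multiplication. For a permutation $g$ of $\{1,2,3\}$, the conjugate operation $\mu^g$ on $Q$ is the binary operation for which $$\mu^g(x_{g(1)},x_{g(2)})=x_{g(3)}\iff x_1\cdot x_2=x_3\qquad(x_1,x_2,x_3\in Q).$$ The conjugate pique $Q^g$ is $(Q,\mu^g,e)$ with the divisions belonging to the multiplication $\mu^g$; it is central if $Q$ is. *Triality* is the assignment $T_g\colon Q\mapsto Q^g$, $f\mapsto f$, on the category of central piques. **Theorem** (Homogeneous representation of central piques). Let $$S=\mathbb Z\langle X_1,X_2,X_3\mid 1+X_3X_2X_1,\ 1+X_2X_1X_3,\ 1+X_1X_3X_2\rangle$$ be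 the unital ring on non-commuting variables $X_1,X_2,X_3$ subject to $X_3X_2X_1=X_2X_1X_3=X_1X_3X_2=-1$; the $X_i$ are then invertible in $S$. (a) There are ring automorphisms $\sigma,\tau$ of $S$ with $$\sigma\colon X_1\mapsto X_2^{-1},\ X_2\mapsto X_1^{-1},\ X_3\mapsto X_3^{-1},\qquad \tau\colon X_1\mapsto X_1^{-1},\ X_2\mapsto X_3^{-1},\ X_3\mapsto X_2^{-1},$$ and there is an isomorphism $g\mapsto\varphi_g$ from the symmetric group $S_3$ onto the group of automorphisms generated by $\sigma$ and $\tau$, with $\varphi_{(1\,2)}=\sigma$ and $\varphi_{(2\,3)}=\tau$. (b) For each right $S$-module $M$, the operations $$x\cdot y=xX_2+yX_1^{-1},\quad x/y=xX_2^{-1}+yX_3,\quad x\backslash y=xX_3^{-1}+yX_1,\quad e=0$$ make the set $M$ into a central pique $F(M)$. The functor $F$, which keeps the underlying functions of morphisms, is an equivalence from the category of right $S$-modules to the category of central piques. Moreover, $F$ is bijective on objects: each central pique structure on a set arises in this way from exactly one right $S$-module structure on that set. (c) Triality is an action of $S_3$ on central piques: $T_1$ is the identity, and applying $T_g$ and then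 $T_h$ gives $T_{g\circ h}$. It is induced by the action of $S_3$ on $S$ from (a): for each $g\in S_3$, if $M^g$ denotes the abelian group $M$ on which $s\in S$ acts as $\varphi_g(s)$ acts on $M$, then $F(M^g)=F(M)^g$, naturally in $M$. In particular, on $F(M)$ one has $$\mu^g(x,y)=x\,\varphi_g(X_2)+y\,\varphi_g(X_1^{-1}).$$ -/

import Mathlib

open CategoryTheory
open scoped RightActions

universe u

namespace CentralPiqueRep

/-! ### Quasigroups, piques, centrality -/

/-- An equational quasigroup structure: multiplication `x · y`, right division `x / y`,
left division `x \ y`. -/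
@[ext]
structure QuasigroupStr (Q : Type u) where
  mul : Q → Q → Q
  rdiv : Q → Q → Q
  ldiv : Q → Q → Q
  sl : ∀ x y, mul x (ldiv x y) = y
  sr : ∀ x y, mul (rdiv y x) x = y
  il : ∀ x y, ldiv x (mul x y) = y
  ir : ∀ x y, rdiv (mul y x) x = y

/-- A pique: a quasigroup with a pointed idempotent element. -/
@[ext]
structure PiqueStr (Q : Type u) extends QuasigroupStr Q where
  e : Q
  idem : mul e e = e

namespace QuasigroupStr

variable {Q : Type u}

/-- The direct square of a quasigroup, with componentwise operations. -/
def square (A : QuasigroupStr Q) : QuasigroupStr (Q × Q) where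
  mul p q := (A.mul p.1 q.1, A.mul p.2 q.2)
  rdiv p q := (A.rdiv p.1 q.1, A.rdiv p.2 q.2)
  ldiv p q := (A.ldiv p.1 q.1, A.ldiv p.2 q.2)
  sl p q := by simp [A.sl]
  sr p q := by simp [A.sr]
  il p q := by simp [A.il]
  ir p q := by simp [A.ir]

/-- Congruences: equivalence relations compatible with all three operations. -/
structure IsCongruence (A : QuasigroupStr Q) (r : Setoid Q) : Prop where
  mul : ∀ {x x' y y'}, r x x' → r y y' → r (A.mul x y) (A.mul x' y')
  rdiv : ∀ {x x' y y'}, r x x' → r y y' → r (A.rdiv x y) (A.rdiv x' y')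
  ldiv : ∀ {x x' y y'}, r x x' → r y y' → r (A.ldiv x y) (A.ldiv x' y')

/-- `Q` is central if the diagonal is a congruence class of some congruence on `Q × Q`. -/
def IsCentral (A : QuasigroupStr Q) : Prop :=
  ∃ r : Setoid (Q × Q), A.square.IsCongruence r ∧ {p : Q × Q | p.1 = p.2} ∈ r.classes

/-! ### Triality -/

/-- The conjugate operation `μ^g`. With positions `1, 2, 3` written as `0, 1, 2 : Fin 3`, it places
`x` in position `g 0` and `y` in position `g 1`, and returns the entry in position `g 2`
that makes `x₁ · x₂ = x₃` (equivalently `x₃ / x₂ = x₁`, equivalently `x₁ \ x₃ = x₂`) true;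
see `conjOp_iff`. -/
def conjOp (A : QuasigroupStr Q) (g : Equiv.Perm (Fin 3)) (x y : Q) : Q :=
  let t : Fin 3 → Q := fun i => if i = g 0 then x else y
  match g 2 with
  | 0 => A.rdiv (t 2) (t 1)
  | 1 => A.ldiv (t 0) (t 2)
  | 2 => A.mul (t 0) (t 1)

theorem mul_eq_iff_rdiv (A : QuasigroupStr Q) (x y z : Q) : A.rdiv z y = x ↔ A.mul x y = z :=
  ⟨fun h => by rw [← h, A.sr], fun h => by rw [← h, A.ir]⟩

theorem mul_eq_iff_ldiv (A : QuasigroupStr Q) (x y z : Q) : A.ldiv x z = y ↔ A.mul x y = z :=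
  ⟨fun h => by rw [← h, A.sl], fun h => by rw [← h, A.il]⟩

/-- The defining property of `μ^g`. -/
theorem conjOp_iff (A : QuasigroupStr Q) (g : Equiv.Perm (Fin 3)) (t : Fin 3 → Q) :
    A.conjOp g (t (g 0)) (t (g 1)) = t (g 2) ↔ A.mul (t 0) (t 1) = t 2 := by
  have h01 : g 0 ≠ g 1 := g.injective.ne (by decide)
  have h02 : g 0 ≠ g 2 := g.injective.ne (by decide)
  have h12 : g 1 ≠ g 2 := g.injective.ne (by decide)
  unfold conjOp
  generalize g 0 = a at *
  generalize g 1 = b at *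
  generalize g 2 = c at *
  fin_cases a <;> fin_cases b <;> fin_cases c <;>
    simp_all [mul_eq_iff_rdiv, mul_eq_iff_ldiv]

theorem conjOp_swap_ldiv (A : QuasigroupStr Q) (g : Equiv.Perm (Fin 3)) (x y z : Q) :
    A.conjOp (g * Equiv.swap 1 2) x z = y ↔ A.conjOp g x y = z := by
  have h1 := A.conjOp_iff (g * Equiv.swap 1 2) (fun i => ![x, y, z] (g.symm i))
  have h2 := A.conjOp_iff g (fun i => ![x, y, z] (g.symm i))
  simp [Equiv.swap_apply_of_ne_of_ne] at h1 h2
  exact h1.trans h2.symm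

theorem conjOp_swap_rdiv (A : QuasigroupStr Q) (g : Equiv.Perm (Fin 3)) (x y z : Q) :
    A.conjOp (g * Equiv.swap 0 2) z y = x ↔ A.conjOp g x y = z := by
  have h1 := A.conjOp_iff (g * Equiv.swap 0 2) (fun i => ![x, y, z] (g.symm i))
  have h2 := A.conjOp_iff g (fun i => ![x, y, z] (g.symm i))
  simp [Equiv.swap_apply_of_ne_of_ne] at h1 h2
  exact h1.trans h2.symm

/-- The conjugate quasigroup with multiplication `μ^g`; its divisions are the right and left
divisions belonging to that multiplication. -/
def conj (A : QuasigroupStr Q) (g : Equiv.Perm (Fin 3)) : QuasigroupStr Q where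
  mul := A.conjOp g
  rdiv := A.conjOp (g * Equiv.swap 0 2)
  ldiv := A.conjOp (g * Equiv.swap 1 2)
  sl x y := (A.conjOp_swap_ldiv g x _ y).1 rfl
  sr x y := (A.conjOp_swap_rdiv g _ x y).1 rfl
  il x y := (A.conjOp_swap_ldiv g x y _).2 rfl
  ir x y := (A.conjOp_swap_rdiv g y x _).2 rfl

theorem square_conjOp (A : QuasigroupStr Q) (g : Equiv.Perm (Fin 3)) (p q : Q × Q) :
    A.square.conjOp g p q = (A.conjOp g p.1 q.1, A.conjOp g p.2 q.2) := by
  unfold conjOp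
  generalize g 2 = c
  fin_cases c <;> simp [square, apply_ite Prod.fst, apply_ite Prod.snd]

theorem IsCongruence.conjOp {A : QuasigroupStr Q} {r : Setoid Q} (h : A.IsCongruence r)
    (g : Equiv.Perm (Fin 3)) {x x' y y' : Q} (hx : r x x') (hy : r y y') :
    r (A.conjOp g x y) (A.conjOp g x' y') := by
  have ht : ∀ i, r (if i = g 0 then x else y) (if i = g 0 then x' else y') := by
    intro i; split_ifs <;> assumption
  unfold QuasigroupStr.conjOp
  generalize g 2 = c
  fin_cases c
  · exact h.rdiv (ht _) (ht _)
  · exact h.ldiv (ht _) (ht _)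
  · exact h.mul (ht _) (ht _)

theorem IsCentral.conj {A : QuasigroupStr Q} (h : A.IsCentral) (g : Equiv.Perm (Fin 3)) :
    (A.conj g).IsCentral := by
  obtain ⟨r, hr, hd⟩ := h
  refine ⟨r, ⟨?_, ?_, ?_⟩, hd⟩
  · intro x x' y y' hx hy
    have := hr.conjOp g hx hy
    rwa [square_conjOp, square_conjOp] at this
  · intro x x' y y' hx hy
    have := hr.conjOp (g * Equiv.swap 0 2) hx hy
    rwa [square_conjOp, square_conjOp] at this
  · intro x x' y y' hx hy
    have := hr.conjOp (g * Equiv.swap 1 2) hx hy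
    rwa [square_conjOp, square_conjOp] at this

end QuasigroupStr

/-- The conjugate pique: conjugate quasigroup, same pointed idempotent. -/
def PiqueStr.conj {Q : Type u} (A : PiqueStr Q) (g : Equiv.Perm (Fin 3)) : PiqueStr Q where
  toQuasigroupStr := A.toQuasigroupStr.conj g
  e := A.e
  idem := (A.conjOp_iff g (fun _ => A.e)).2 A.idem

/-! ### The category of central piques -/

/-- Central piques. -/
structure CentralPique : Type (u + 1) where
  carrier : Type u
  str : PiqueStr carrier
  central : str.IsCentral

namespace CentralPique

/-- Pique homomorphisms. -/
@[ext]
structure Hom (P P' : CentralPique.{u}) : Type u where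
  toFun : P.carrier → P'.carrier
  map_mul : ∀ x y, toFun (P.str.mul x y) = P'.str.mul (toFun x) (toFun y)
  map_rdiv : ∀ x y, toFun (P.str.rdiv x y) = P'.str.rdiv (toFun x) (toFun y)
  map_ldiv : ∀ x y, toFun (P.str.ldiv x y) = P'.str.ldiv (toFun x) (toFun y)
  map_e : toFun P.str.e = P'.str.e

instance : Category CentralPique.{u} where
  Hom := Hom
  id P := ⟨id, fun _ _ => rfl, fun _ _ => rfl, fun _ _ => rfl, rfl⟩
  comp f g := ⟨g.toFun ∘ f.toFun, by simp [f.map_mul, g.map_mul], by simp [f.map_rdiv, g.map_rdiv],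
    by simp [f.map_ldiv, g.map_ldiv], by simp [f.map_e, g.map_e]⟩

theorem Hom.map_conjOp {P P' : CentralPique.{u}} (f : Hom P P') (g : Equiv.Perm (Fin 3))
    (x y : P.carrier) :
    f.toFun (P.str.conjOp g x y) = P'.str.conjOp g (f.toFun x) (f.toFun y) := by
  unfold QuasigroupStr.conjOp
  generalize g 2 = c
  fin_cases c <;> simp [f.map_mul, f.map_rdiv, f.map_ldiv, apply_ite f.toFun]

/-- The triality action of `g` on central piques: `(Q, μ, e) ↦ (Q, μ^g, e)`, and homomorphisms
are kept as functions. -/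
def triality (g : Equiv.Perm (Fin 3)) : CentralPique.{u} ⥤ CentralPique.{u} where
  obj P := ⟨P.carrier, P.str.conj g, P.central.conj g⟩
  map f := ⟨f.toFun, f.map_conjOp _, f.map_conjOp _, f.map_conjOp _, f.map_e⟩

end CentralPique

/-! ### The coefficient algebra `S` -/

/-- The defining relations; the variables `X₁, X₂, X₃` are `ι 0, ι 1, ι 2`. -/
inductive CoeffRel : FreeAlgebra ℤ (Fin 3) → FreeAlgebra ℤ (Fin 3) → Prop
  | r321 : CoeffRel
      (1 + FreeAlgebra.ι ℤ 2 * FreeAlgebra.ι ℤ 1 * FreeAlgebra.ι ℤ 0) 0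
  | r213 : CoeffRel
      (1 + FreeAlgebra.ι ℤ 1 * FreeAlgebra.ι ℤ 0 * FreeAlgebra.ι ℤ 2) 0
  | r132 : CoeffRel
      (1 + FreeAlgebra.ι ℤ 0 * FreeAlgebra.ι ℤ 2 * FreeAlgebra.ι ℤ 1) 0

/-- `S = ℤ⟨X₁, X₂, X₃ ∣ 1 + X₃X₂X₁, 1 + X₂X₁X₃, 1 + X₁X₃X₂⟩`. -/
def CoeffAlg : Type := RingQuot CoeffRel

noncomputable instance : Ring CoeffAlg := inferInstanceAs (Ring (RingQuot CoeffRel))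

/-- The quotient map from the free algebra. -/
noncomputable def CoeffAlg.mk : FreeAlgebra ℤ (Fin 3) →+* CoeffAlg := RingQuot.mkRingHom CoeffRel

theorem CoeffAlg.mk_rel {a b : FreeAlgebra ℤ (Fin 3)} (h : CoeffRel a b) :
    CoeffAlg.mk a = CoeffAlg.mk b := RingQuot.mkRingHom_rel h

/-- The image in `S` of the `i`-th free generator. -/
noncomputable def gen (i : Fin 3) : CoeffAlg :=
  CoeffAlg.mk (FreeAlgebra.ι ℤ i)

theorem gen_321 : gen 2 * gen 1 * gen 0 = -1 := by
  have h := CoeffAlg.mk_rel CoeffRel.r321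
  simp only [map_add, map_mul, map_one, map_zero] at h
  exact (neg_eq_of_add_eq_zero_right h).symm

theorem gen_213 : gen 1 * gen 0 * gen 2 = -1 := by
  have h := CoeffAlg.mk_rel CoeffRel.r213
  simp only [map_add, map_mul, map_one, map_zero] at h
  exact (neg_eq_of_add_eq_zero_right h).symm

theorem gen_132 : gen 0 * gen 2 * gen 1 = -1 := by
  have h := CoeffAlg.mk_rel CoeffRel.r132
  simp only [map_add, map_mul, map_one, map_zero] at h
  exact (neg_eq_of_add_eq_zero_right h).symm

/-- The variable `X₁`, as a unit of `S`. -/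
noncomputable def X₁ : CoeffAlgˣ where
  val := gen 0
  inv := -(gen 2 * gen 1)
  val_inv := by rw [mul_neg, ← mul_assoc, gen_132, neg_neg]
  inv_val := by rw [neg_mul, gen_321, neg_neg]

/-- The variable `X₂`, as a unit of `S`. -/
noncomputable def X₂ : CoeffAlgˣ where
  val := gen 1
  inv := -(gen 0 * gen 2)
  val_inv := by rw [mul_neg, ← mul_assoc, gen_213, neg_neg]
  inv_val := by rw [neg_mul, gen_132, neg_neg]

/-- The variable `X₃`, as a unit of `S`. -/
noncomputable def X₃ : CoeffAlgˣ where
  val := gen 2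
  inv := -(gen 1 * gen 0)
  val_inv := by rw [mul_neg, ← mul_assoc, gen_321, neg_neg]
  inv_val := by rw [neg_mul, gen_213, neg_neg]

theorem X₃_mul_X₂ : (X₃ : CoeffAlg) * X₂ = -↑X₁⁻¹ := (neg_neg _).symm

theorem X₁_mul_X₃ : (X₁ : CoeffAlg) * X₃ = -↑X₂⁻¹ := (neg_neg _).symm

theorem X₂_mul_X₁ : (X₂ : CoeffAlg) * X₁ = -↑X₃⁻¹ := (neg_neg _).symm

/-! ### From right `S`-modules to central piques

Right `S`-modules are modules over `Sᵐᵒᵖ`, and `x <• s` is the right action of `s` on `x`. -/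

section Lin

variable (M : Type u) [AddCommGroup M] [Module CoeffAlgᵐᵒᵖ M]

theorem act_act (x : M) (a b : CoeffAlg) : x <• a <• b = x <• (a * b) := by
  rw [MulOpposite.op_mul, mul_smul]

/-- The pique on a right `S`-module with `x·y = xX₂ + yX₁⁻¹`, `x/y = xX₂⁻¹ + yX₃`,
`x\y = xX₃⁻¹ + yX₁`, `e = 0`. -/
noncomputable def linStr : PiqueStr M where
  mul x y := x <• (X₂ : CoeffAlg) + y <• (↑X₁⁻¹ : CoeffAlg)
  rdiv x y := x <• (↑X₂⁻¹ : CoeffAlg) + y <• (X₃ : CoeffAlg)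
  ldiv x y := x <• (↑X₃⁻¹ : CoeffAlg) + y <• (X₁ : CoeffAlg)
  e := 0
  sl x y := by
    have h : (↑X₃⁻¹ : CoeffAlg) * ↑X₁⁻¹ = -X₂ := by
      rw [← Units.val_mul, ← mul_inv_rev, Units.inv_eq_of_mul_eq_one_right]
      simp [X₁_mul_X₃]
    rw [smul_add, act_act, act_act, h, Units.mul_inv]; simp
  sr x y := by
    rw [smul_add, act_act, act_act, X₃_mul_X₂, Units.inv_mul]; simp
  il x y := by
    rw [smul_add, act_act, act_act, X₂_mul_X₁, Units.inv_mul]; simp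
  ir x y := by
    have h : (↑X₁⁻¹ : CoeffAlg) * ↑X₂⁻¹ = -X₃ := by
      rw [← Units.val_mul, ← mul_inv_rev, Units.inv_eq_of_mul_eq_one_right]
      simp [X₂_mul_X₁]
    rw [smul_add, act_act, act_act, h, Units.mul_inv]; simp
  idem := by simp

theorem linStr_isCentral : (linStr M).IsCentral := by
  refine ⟨Setoid.ker (fun p : M × M => p.1 - p.2), ⟨?_, ?_, ?_⟩, 0, ?_⟩
  · intro x x' y y' hx hy
    simp only [Setoid.ker_def, QuasigroupStr.square, linStr, add_sub_add_comm, ← smul_sub] at *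
    rw [hx, hy]
  · intro x x' y y' hx hy
    simp only [Setoid.ker_def, QuasigroupStr.square, linStr, add_sub_add_comm, ← smul_sub] at *
    rw [hx, hy]
  · intro x x' y y' hx hy
    simp only [Setoid.ker_def, QuasigroupStr.square, linStr, add_sub_add_comm, ← smul_sub] at *
    rw [hx, hy]
  · ext p
    simp [Setoid.ker_def, sub_eq_zero]

end Lin

/-- The functor from right `S`-modules to central piques: `linStr` on objects, and linear maps
are kept as functions. -/
noncomputable def linPique : ModuleCat.{u} CoeffAlgᵐᵒᵖ ⥤ CentralPique.{u} where
  obj M := ⟨M, linStr M, linStr_isCentral M⟩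
  map f := ⟨f.hom, fun _ _ => by simp [linStr], fun _ _ => by simp [linStr],
    fun _ _ => by simp [linStr], map_zero _⟩

/-- The action of an automorphism `f` of `S` on right `S`-modules: same abelian group, with `s`
now acting as `f s` did. -/
noncomputable def twist (f : RingAut CoeffAlg) :
    ModuleCat.{u} CoeffAlgᵐᵒᵖ ⥤ ModuleCat.{u} CoeffAlgᵐᵒᵖ :=
  ModuleCat.restrictScalars (RingEquiv.op f).toRingHom

end CentralPiqueRep

open CentralPiqueRep

namespace CentralPiqueRep

/-! ### Maps out of the coefficient algebra -/

/-! The three relators are the rotations of $X_3X_2X_1=-1$. An even permutation of the indices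
preserves this cyclic order. An odd one reverses it, and inverting the generators reverses it back.
Hence $X_i\mapsto X_{g(i)}^{\operatorname{sgn} g}$ respects the relations, and $g\mapsto\varphi_g$
is multiplicative because the sign is. A rational character of $S$ shows that the action is
faithful.

For (b), the key is that a congruence with the diagonal as a class makes a difference term $x-y$ on
$Q$ a pique homomorphism $Q\times Q\to Q$ (`PiqueStr.sub_mul`, `PiqueStr.sub_rdiv`,
`PiqueStr.sub_ldiv`). As this term is itself built from the operations and $e$, it is medial, and so
it is the subtraction of an abelian group in which multiplication is additive: $x\cdot
y=x\cdot0+0\cdot y$. The maps $0\backslash x$, $x\cdot0$, $0/x$ then satisfy the relations of $S$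
(`exists_module`). Conversely, addition and the action of each $X_i$ are pique terms, so pique
homomorphisms are linear (`linear_of_pique_hom`). This gives fullness and, applied to the identity
map, uniqueness of the module structure.

For (c), conjugation permutes the positions of the ternary relation $x_1\cdot x_2=x_3$, and the
coefficients of the six conjugates are those given by $\varphi_g$ (`linStr_conjOp`). -/

theorem CoeffAlg.ringHom_ext {R : Type*} [Ring R] {f g : CoeffAlg →+* R}
    (h : ∀ i, f (gen i) = g (gen i)) : f = g := by
  apply RingQuot.ringQuot_ext
  have : (f.comp CoeffAlg.mk).toIntAlgHom = (g.comp CoeffAlg.mk).toIntAlgHom :=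
    FreeAlgebra.hom_ext (funext h)
  exact congrArg (fun k : FreeAlgebra ℤ (Fin 3) →ₐ[ℤ] R => (k : FreeAlgebra ℤ (Fin 3) →+* R)) this

/-- The universal property of `S`. -/
noncomputable def CoeffAlg.lift {R : Type*} [Ring R] (a : Fin 3 → R) (h₁ : a 2 * a 1 * a 0 = -1)
    (h₂ : a 1 * a 0 * a 2 = -1) (h₃ : a 0 * a 2 * a 1 = -1) : CoeffAlg →+* R :=
  RingQuot.lift ⟨(FreeAlgebra.lift ℤ a : FreeAlgebra ℤ (Fin 3) →+* R), by
    rintro _ _ (_ | _ | _) <;> simp [h₁, h₂, h₃]⟩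

@[simp]
theorem CoeffAlg.lift_gen {R : Type*} [Ring R] (a : Fin 3 → R) (h₁ : a 2 * a 1 * a 0 = -1)
    (h₂ : a 1 * a 0 * a 2 = -1) (h₃ : a 0 * a 2 * a 1 = -1) (i : Fin 3) :
    CoeffAlg.lift a h₁ h₂ h₃ (gen i) = a i := by
  have := RingQuot.lift_mkRingHom_apply (r := CoeffRel)
    (FreeAlgebra.lift ℤ a : FreeAlgebra ℤ (Fin 3) →+* R) (by
    rintro _ _ (_ | _ | _) <;> simp [h₁, h₂, h₃]) (FreeAlgebra.ι ℤ i)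
  refine this.trans ?_
  simp

/-- The family of units `X₁, X₂, X₃`. -/
noncomputable def genUnit (i : Fin 3) : CoeffAlgˣ := ![X₁, X₂, X₃] i

theorem val_genUnit (i : Fin 3) : (genUnit i : CoeffAlg) = gen i := by
  fin_cases i <;> rfl

/-- A cyclic rotation of a factorization of `-1` is a factorization of `-1`. -/
theorem mul_eq_neg_one_rotate {R : Type*} [Ring R] {a b c : Rˣ} (h : a * b * c = -1) :
    b * c * a = -1 := by
  have : b * c = a⁻¹ * -1 := by rw [← h]; group
  rw [this]
  simp

/-! ### The symmetric group acting on `S` -/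

theorem perm_three_cases (g : Equiv.Perm (Fin 3)) :
    g = 1 ∨ g = Equiv.swap 0 1 ∨ g = Equiv.swap 1 2 ∨ g = Equiv.swap 0 2 ∨
      g = Equiv.swap 0 1 * Equiv.swap 1 2 ∨ g = Equiv.swap 1 2 * Equiv.swap 0 1 := by
  revert g; decide

theorem genUnit_two_one_zero : genUnit 2 * genUnit 1 * genUnit 0 = -1 :=
  Units.ext (by simpa [val_genUnit] using gen_321)

/-- The image of `X_i` under the automorphism of `S` belonging to `g`. -/
noncomputable def permUnit (g : Equiv.Perm (Fin 3)) (i : Fin 3) : CoeffAlgˣ :=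
  genUnit (g i) ^ (Equiv.Perm.sign g : ℤ)

/-- For even `g` this is a rotation of the relation $X_3X_2X_1=-1$; for odd `g` it is the inverse of
such a rotation. -/
theorem permUnit_mul (g : Equiv.Perm (Fin 3)) :
    permUnit g 2 * permUnit g 1 * permUnit g 0 = -1 := by
  have h₁ := genUnit_two_one_zero
  have h₂ := mul_eq_neg_one_rotate h₁
  have h₃ := mul_eq_neg_one_rotate h₂
  have k : (-1 : CoeffAlgˣ)⁻¹ = -1 := by simp
  -- Inversion reverses the factors, which supplies the relations for the three transpositions.
  have e₁ := congrArg (·⁻¹) h₁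
  have e₂ := congrArg (·⁻¹) h₂
  have e₃ := congrArg (·⁻¹) h₃
  simp only [k, mul_inv_rev, ← mul_assoc] at e₁ e₂ e₃
  rcases perm_three_cases g with rfl | rfl | rfl | rfl | rfl | rfl <;>
    simp [permUnit, Equiv.swap_apply_of_ne_of_ne, h₁, h₂, h₃, e₁, e₂, e₃]

/-- The endomorphism of `S` with `X_i ↦ X_{g i} ^ sign g`. -/
noncomputable def permHom (g : Equiv.Perm (Fin 3)) : CoeffAlg →+* CoeffAlg :=
  CoeffAlg.lift (fun i => permUnit g i)
    (by have := permUnit_mul g; exact congrArg Units.val this)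
    (by have := mul_eq_neg_one_rotate (permUnit_mul g); exact congrArg Units.val this)
    (by
      have := mul_eq_neg_one_rotate (mul_eq_neg_one_rotate (permUnit_mul g))
      exact congrArg Units.val this)

theorem permHom_gen (g : Equiv.Perm (Fin 3)) (i : Fin 3) : permHom g (gen i) = permUnit g i :=
  CoeffAlg.lift_gen ..

theorem map_permHom_genUnit (g : Equiv.Perm (Fin 3)) (i : Fin 3) :
    Units.map (permHom g : CoeffAlg →* CoeffAlg) (genUnit i) = permUnit g i :=
  Units.ext (by simp [val_genUnit, permHom_gen])

theorem permHom_one : permHom 1 = RingHom.id CoeffAlg :=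
  CoeffAlg.ringHom_ext fun i => by simp [permHom_gen, permUnit, val_genUnit]

theorem permHom_mul (g h : Equiv.Perm (Fin 3)) :
    permHom (g * h) = (permHom g).comp (permHom h) :=
  CoeffAlg.ringHom_ext fun i => by
    have : Units.map (permHom g : CoeffAlg →* CoeffAlg) (permUnit h i) = permUnit (g * h) i := by
      rw [permUnit, map_zpow, map_permHom_genUnit, permUnit, permUnit, ← zpow_mul]
      simp
    rw [permHom_gen, RingHom.comp_apply, permHom_gen, ← this]
    rfl

/-- The action of the symmetric group on `S`. -/
noncomputable def permAut : Equiv.Perm (Fin 3) →* RingAut CoeffAlg where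
  toFun g := RingEquiv.ofRingHom (permHom g) (permHom g⁻¹)
    (by rw [← permHom_mul, mul_inv_cancel, permHom_one])
    (by rw [← permHom_mul, inv_mul_cancel, permHom_one])
  map_one' := RingEquiv.ext fun x => by
    change permHom 1 x = x
    rw [permHom_one]; rfl
  map_mul' g h := RingEquiv.ext fun x => by
    change permHom (g * h) x = permHom g (permHom h x)
    rw [permHom_mul]; rfl

theorem permAut_gen (g : Equiv.Perm (Fin 3)) (i : Fin 3) : permAut g (gen i) = permUnit g i :=
  permHom_gen g i

theorem permAut_genUnit (g : Equiv.Perm (Fin 3)) (i : Fin 3) :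
    permAut g (genUnit i : CoeffAlg) = permUnit g i := by
  rw [val_genUnit, permAut_gen]

theorem permAut_genUnit_inv (g : Equiv.Perm (Fin 3)) (i : Fin 3) :
    permAut g (↑(genUnit i)⁻¹ : CoeffAlg) = ↑(permUnit g i)⁻¹ := by
  have := congrArg (fun u : CoeffAlgˣ => (↑u⁻¹ : CoeffAlg)) (map_permHom_genUnit g i)
  rw [← this]
  rfl

/-- Values of the generators in `ℚ` under a character of `S`. -/
def ratVal : Fin 3 → ℚ
  | 0 => 2
  | 1 => 3
  | 2 => -1 / 6

@[simp] theorem ratVal_zero : ratVal 0 = 2 := rfl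

@[simp] theorem ratVal_one : ratVal 1 = 3 := rfl

@[simp] theorem ratVal_two : ratVal 2 = -1 / 6 := rfl

/-- The character of `S` with `X₁ ↦ 2`, `X₂ ↦ 3`, `X₃ ↦ -1/6`. -/
noncomputable def ratChar : CoeffAlg →+* ℚ :=
  CoeffAlg.lift ratVal (by norm_num) (by norm_num) (by norm_num)

theorem map_ratChar_genUnit (i : Fin 3) :
    ratChar (genUnit i : CoeffAlg) = ratVal i := by
  rw [val_genUnit]
  exact CoeffAlg.lift_gen ..

theorem ratChar_permAut (g : Equiv.Perm (Fin 3)) (i : Fin 3) :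
    ratChar (permAut g (gen i)) =
      ratVal (g i) ^ (Equiv.Perm.sign g : ℤ) := by
  rw [permAut_gen, permUnit, ← map_ratChar_genUnit]
  have := map_zpow (Units.map (ratChar : CoeffAlg →* ℚ)) (genUnit (g i)) (Equiv.Perm.sign g : ℤ)
  have := congrArg Units.val this
  rwa [Units.val_zpow_eq_zpow_val] at this

/-- Under the character, the six possible images of $X_1$ take the distinct values $2,3,-1/6$ and
$1/2,1/3,-6$, so only the identity permutation fixes $X_1$. -/
theorem permAut_injective : Function.Injective permAut := by
  rw [injective_iff_map_eq_one]
  intro g hg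
  have h₀ := ratChar_permAut g 0
  have h₁ := ratChar_permAut g 1
  rw [hg] at h₀ h₁
  simp only [RingAut.one_apply, ← val_genUnit, map_ratChar_genUnit] at h₀ h₁
  rcases perm_three_cases g with rfl | rfl | rfl | rfl | rfl | rfl <;>
    simp [Equiv.swap_apply_of_ne_of_ne] at h₀ h₁ ⊢ <;>
    norm_num at h₀

theorem closure_swaps :
    Subgroup.closure {Equiv.swap (0 : Fin 3) 1, Equiv.swap (1 : Fin 3) 2} = ⊤ := by
  rw [eq_top_iff]
  rintro g -
  have hs : Equiv.swap (0 : Fin 3) 1 ∈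
      Subgroup.closure {Equiv.swap (0 : Fin 3) 1, Equiv.swap (1 : Fin 3) 2} :=
    Subgroup.subset_closure (by simp)
  have ht : Equiv.swap (1 : Fin 3) 2 ∈
      Subgroup.closure {Equiv.swap (0 : Fin 3) 1, Equiv.swap (1 : Fin 3) 2} :=
    Subgroup.subset_closure (by simp)
  rcases perm_three_cases g with rfl | rfl | rfl | rfl | rfl | rfl
  · exact one_mem _
  · exact hs
  · exact ht
  · have : Equiv.swap (0 : Fin 3) 2 = Equiv.swap 0 1 * Equiv.swap 1 2 * Equiv.swap 0 1 := by decide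
    rw [this]
    exact mul_mem (mul_mem hs ht) hs
  · exact mul_mem hs ht
  · exact mul_mem ht hs

theorem range_permAut : permAut.range =
    Subgroup.closure {permAut (Equiv.swap 0 1), permAut (Equiv.swap 1 2)} := by
  rw [MonoidHom.range_eq_map, ← closure_swaps, MonoidHom.map_closure, Set.image_pair]

/-- The symmetric group as the group generated by `σ` and `τ`. -/
noncomputable def permAutEquiv : Equiv.Perm (Fin 3) ≃*
    Subgroup.closure {permAut (Equiv.swap 0 1), permAut (Equiv.swap 1 2)} :=
  (MonoidHom.ofInjective permAut_injective).trans (MulEquiv.subgroupCongr range_permAut)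

/-! ### Triality -/

namespace QuasigroupStr

variable {Q : Type u}

/-- A quasigroup structure is determined by its multiplication. -/
theorem ext_mul {A B : QuasigroupStr Q} (h : A.mul = B.mul) : A = B := by
  refine QuasigroupStr.ext h ?_ ?_
  · funext x y
    rw [A.mul_eq_iff_rdiv, h, B.sr]
  · funext x y
    rw [A.mul_eq_iff_ldiv, h, B.sl]

theorem conj_conj (A : QuasigroupStr Q) (g h : Equiv.Perm (Fin 3)) :
    (A.conj g).conj h = A.conj (g * h) := by
  apply ext_mul
  funext x y
  change (A.conj g).conjOp h x y = A.conjOp (g * h) x y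
  generalize hz : A.conjOp (g * h) x y = z
  -- The triple with `x`, `y`, `z` in positions `(g * h) 0`, `(g * h) 1`, `(g * h) 2`. Both
  -- conjugates are then read off from the one equation `A.mul (t 0) (t 1) = t 2`, the iterated one
  -- through the reindexed triple `t ∘ g`.
  let t : Fin 3 → Q := fun i => ![x, y, z] ((g * h).symm i)
  have ht : ∀ i, t ((g * h) i) = ![x, y, z] i := fun i => by
    change ![x, y, z] ((g * h).symm ((g * h) i)) = _
    rw [Equiv.symm_apply_apply]
  have h₁ := A.conjOp_iff (g * h) t
  have h₂ := A.conjOp_iff g t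
  have h₃ := (A.conj g).conjOp_iff h (fun i => t (g i))
  rw [ht, ht, ht] at h₁
  have e : ∀ i, t (g (h i)) = ![x, y, z] i := ht
  simp only [e] at h₃
  exact h₃.2 (h₂.2 (h₁.1 hz))

end QuasigroupStr

theorem PiqueStr.ext_mul {Q : Type u} {A B : PiqueStr Q} (h : A.mul = B.mul) (he : A.e = B.e) :
    A = B := by
  have := QuasigroupStr.ext_mul h
  cases A; cases B
  simp_all

theorem PiqueStr.conj_one {Q : Type u} (A : PiqueStr Q) : A.conj 1 = A :=
  PiqueStr.ext_mul rfl rfl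

theorem PiqueStr.conj_conj {Q : Type u} (A : PiqueStr Q) (g h : Equiv.Perm (Fin 3)) :
    (A.conj g).conj h = A.conj (g * h) :=
  PiqueStr.ext_mul (congrArg QuasigroupStr.mul (A.toQuasigroupStr.conj_conj g h)) rfl

namespace CentralPique

theorem mk_congr {Q : Type u} {A B : PiqueStr Q} (h : A = B) (hA : A.IsCentral)
    (hB : B.IsCentral) : (⟨Q, A, hA⟩ : CentralPique.{u}) = ⟨Q, B, hB⟩ := by
  subst h; rfl

/-- Used for strict equality of functors: the objects agree only propositionally, though on the same
carriers, so morphisms are compared through their underlying functions. -/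
theorem hom_heq {Q Q' : Type u} {A B : PiqueStr Q} {A' B' : PiqueStr Q'} (h : A = B)
    (h' : A' = B') {hA : A.IsCentral} {hB : B.IsCentral} {hA' : A'.IsCentral}
    {hB' : B'.IsCentral} (f : (⟨Q, A, hA⟩ : CentralPique.{u}) ⟶ ⟨Q', A', hA'⟩)
    (g : (⟨Q, B, hB⟩ : CentralPique.{u}) ⟶ ⟨Q', B', hB'⟩) (hfg : f.toFun = g.toFun) :
    HEq f g := by
  subst h h'
  exact heq_of_eq (Hom.ext hfg)

theorem triality_one : triality.{u} 1 = 𝟭 CentralPique.{u} :=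
  Functor.hext (fun P => mk_congr P.str.conj_one _ _)
    fun P P' _ => hom_heq P.str.conj_one P'.str.conj_one _ _ rfl

theorem triality_comp (g h : Equiv.Perm (Fin 3)) :
    triality.{u} g ⋙ triality.{u} h = triality.{u} (g * h) :=
  Functor.hext (fun P => mk_congr (P.str.conj_conj g h) _ _)
    fun P P' _ => hom_heq (P.str.conj_conj g h) (P'.str.conj_conj g h) _ _ rfl

end CentralPique

/-! ### Triality on the pique of a module -/

/-- The six conjugates are the multiplication, the two divisions and their opposites; the
coefficients match case by case. -/
theorem linStr_conjOp (M : Type u) [AddCommGroup M] [Module CoeffAlgᵐᵒᵖ M]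
    (g : Equiv.Perm (Fin 3)) (x y : M) :
    (linStr M).conjOp g x y =
      x <• permAut g (X₂ : CoeffAlg) + y <• permAut g (↑X₁⁻¹ : CoeffAlg) := by
  have h₂ : permAut g (X₂ : CoeffAlg) = permUnit g 1 := permAut_genUnit g 1
  have h₁ : permAut g (↑X₁⁻¹ : CoeffAlg) = ↑(permUnit g 0)⁻¹ := permAut_genUnit_inv g 0
  rw [h₁, h₂]
  rcases perm_three_cases g with rfl | rfl | rfl | rfl | rfl | rfl <;>
    simp [permUnit, genUnit, Equiv.swap_apply_of_ne_of_ne,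
      QuasigroupStr.conjOp, linStr, add_comm]

theorem linStr_twist (M : ModuleCat.{u} CoeffAlgᵐᵒᵖ) (g : Equiv.Perm (Fin 3)) :
    (linStr ((twist (permAut g)).obj M) : PiqueStr M) = (linStr M).conj g :=
  PiqueStr.ext_mul (funext₂ fun x y => (linStr_conjOp M g x y).symm) rfl

theorem twist_comp_linPique (g : Equiv.Perm (Fin 3)) :
    twist.{u} (permAut g) ⋙ linPique.{u} = linPique.{u} ⋙ CentralPique.triality.{u} g :=
  Functor.hext (fun M => CentralPique.mk_congr (linStr_twist M g) _ _)
    fun M N _ => CentralPique.hom_heq (linStr_twist M g) (linStr_twist N g) _ _ rfl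

end CentralPiqueRep

namespace CentralPiqueRep

/-! ### The abelian group of a central pique -/

/-- An operation with the formal properties of subtraction in an abelian group. -/
structure IsSubtraction {Q : Type u} (d : Q → Q → Q) (e : Q) : Prop where
  sub_zero : ∀ x, d x e = x
  sub_self : ∀ x, d x x = e
  medial : ∀ a b c f, d (d a b) (d c f) = d (d a c) (d b f)

namespace IsSubtraction

variable {Q : Type u} {d : Q → Q → Q} {e : Q}

theorem neg_neg (h : IsSubtraction d e) (x : Q) : d e (d e x) = x := by
  -- The group laws come from the medial law with some entries equal to `e` or repeated.
  have := h.medial x x e x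
  rwa [h.sub_self, h.sub_zero, h.sub_zero] at this

theorem add_comm (h : IsSubtraction d e) (x y : Q) : d x (d e y) = d y (d e x) := by
  have := h.medial e (d e x) (d e y) e
  rwa [h.neg_neg, h.neg_neg, h.sub_zero, h.sub_zero] at this

theorem add_right_comm (h : IsSubtraction d e) (x y z : Q) :
    d (d x (d e y)) (d e z) = d (d x (d e z)) (d e y) := by
  have := h.medial x (d e y) (d e z) e
  rwa [h.sub_zero, h.sub_zero] at this

/-- The abelian group with a given subtraction. -/
abbrev addCommGroup (h : IsSubtraction d e) : AddCommGroup Q where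
  add x y := d x (d e y)
  zero := e
  neg x := d e x
  nsmul := @nsmulRec Q ⟨e⟩ ⟨fun x y => d x (d e y)⟩
  zsmul := @zsmulRec Q ⟨e⟩ ⟨fun x y => d x (d e y)⟩ ⟨fun x => d e x⟩
    (@nsmulRec Q ⟨e⟩ ⟨fun x y => d x (d e y)⟩)
  add_assoc x y z := by
    change d (d x (d e y)) (d e z) = d x (d e (d y (d e z)))
    rw [h.add_comm x (d y (d e z)), h.add_right_comm y z x, h.add_comm x y]
  zero_add x := h.neg_neg x
  add_zero x := by
    change d x (d e e) = x
    rw [h.sub_self, h.sub_zero]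
  neg_add_cancel x := h.sub_self _
  add_comm := h.add_comm

end IsSubtraction

namespace PiqueStr

variable {Q : Type u} (A : PiqueStr Q)

theorem e_rdiv_e : A.rdiv A.e A.e = A.e := by rw [A.mul_eq_iff_rdiv, A.idem]

theorem e_ldiv_e : A.ldiv A.e A.e = A.e := by rw [A.mul_eq_iff_ldiv, A.idem]

/-- The term that is subtraction on a central pique. -/
def sub (x y : Q) : Q := A.mul (A.rdiv x A.e) (A.ldiv (A.rdiv y A.e) A.e)

theorem sub_e (x : Q) : A.sub x A.e = x := by
  rw [sub, e_rdiv_e, e_ldiv_e, A.sr]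

theorem sub_self (x : Q) : A.sub x x = A.e := A.sl _ _

variable {A}

section

variable {r : Setoid (Q × Q)} (hr : A.square.IsCongruence r)
  (hd : {p : Q × Q | p.1 = p.2} ∈ r.classes)

include hd in
theorem rel_diag_iff (x : Q) (p : Q × Q) : r p (x, x) ↔ p.1 = p.2 := by
  obtain ⟨q, hq⟩ := hd
  have key : ∀ p : Q × Q, p.1 = p.2 ↔ r p q := fun p => Set.ext_iff.1 hq p
  have hx : r (x, x) q := (key _).1 rfl
  rw [key]
  exact ⟨fun h => r.trans h hx, fun h => r.trans h (r.symm hx)⟩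

include hr hd

/-- Multiply $(x/e,\,y/e)$ on the right by two related diagonal pairs: $(e,e)$ returns $(x,y)$,
while the pair with entries $(y/e)\backslash e$ sends the second coordinate to $e$. -/
theorem rel_sub (x y : Q) : r (x, y) (A.sub x y, A.e) := by
  have h : r (A.e, A.e) (A.ldiv (A.rdiv y A.e) A.e, A.ldiv (A.rdiv y A.e) A.e) :=
    (rel_diag_iff hd _ _).2 rfl
  have := hr.mul (r.refl (A.rdiv x A.e, A.rdiv y A.e)) h
  simpa only [QuasigroupStr.square, A.sr, A.sl, sub] using this

/-- Multiplying by $(x\backslash e,\,e)$ moves the first pair onto the diagonal, hence also the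
second, and cancellation finishes. With `rel_sub`, every class contains exactly one pair of the form
$(z,e)$. -/
theorem eq_of_rel_e {x y : Q} (h : r (x, A.e) (y, A.e)) : x = y := by
  have := hr.mul h (r.refl (A.ldiv x A.e, A.e))
  simp only [QuasigroupStr.square, A.sl, A.idem] at this
  have hy : A.mul y (A.ldiv x A.e) = A.e := (rel_diag_iff hd _ _).1 (r.symm this)
  rw [← A.ir (A.ldiv x A.e) y, hy, eq_comm, A.mul_eq_iff_rdiv, A.sl]

/-- Both sides are the first coordinate of the representative $(\cdot,e)$ of the class of
$(x,z)\cdot(y,w)$; idempotence of $e$ keeps the second coordinate equal to $e$. -/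
theorem sub_mul (x y z w : Q) :
    A.sub (A.mul x y) (A.mul z w) = A.mul (A.sub x z) (A.sub y w) := by
  have h := hr.mul (rel_sub hr hd x z) (rel_sub hr hd y w)
  simp only [QuasigroupStr.square, A.idem] at h
  exact eq_of_rel_e hr hd (r.trans (r.symm (rel_sub hr hd _ _)) h)

theorem sub_rdiv (x y z w : Q) :
    A.sub (A.rdiv x y) (A.rdiv z w) = A.rdiv (A.sub x z) (A.sub y w) := by
  have h := hr.rdiv (rel_sub hr hd x z) (rel_sub hr hd y w)
  simp only [QuasigroupStr.square, A.e_rdiv_e] at h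
  exact eq_of_rel_e hr hd (r.trans (r.symm (rel_sub hr hd _ _)) h)

theorem sub_ldiv (x y z w : Q) :
    A.sub (A.ldiv x y) (A.ldiv z w) = A.ldiv (A.sub x z) (A.sub y w) := by
  have h := hr.ldiv (rel_sub hr hd x z) (rel_sub hr hd y w)
  simp only [QuasigroupStr.square, A.e_ldiv_e] at h
  exact eq_of_rel_e hr hd (r.trans (r.symm (rel_sub hr hd _ _)) h)

theorem isSubtraction : IsSubtraction A.sub A.e where
  sub_zero := A.sub_e
  sub_self := A.sub_self
  medial a b c f := by
    -- The subtraction term is expanded and the outer subtraction carried through its operations;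
    -- the constants contribute `A.sub e e = e`.
    rw [sub.eq_def A a b, sub.eq_def A c f, sub_mul hr hd, sub_rdiv hr hd, sub_ldiv hr hd,
      sub_rdiv hr hd, A.sub_self, ← sub.eq_def]

end

end PiqueStr

/-- On a central pique there is an abelian group structure with zero `e` for which
multiplication is additive in both arguments together. -/
theorem exists_addCommGroup {Q : Type u} {A : PiqueStr Q} (hA : A.IsCentral) :
    ∃ _ : AddCommGroup Q, A.e = 0 ∧
      ∀ x y z w : Q, A.mul (x + z) (y + w) = A.mul x y + A.mul z w := by
  obtain ⟨r, hr, hd⟩ := hA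
  refine ⟨(PiqueStr.isSubtraction hr hd).addCommGroup, rfl, fun x y z w => ?_⟩
  change A.mul (A.sub x (A.sub A.e z)) (A.sub y (A.sub A.e w)) =
    A.sub (A.mul x y) (A.sub A.e (A.mul z w))
  -- Addition is $x-(e-z)$, so `sub_mul` is needed twice, with $e=e\cdot e$ in between.
  rw [← PiqueStr.sub_mul hr hd, ← PiqueStr.sub_mul hr hd, A.idem]

/-! ### The module of a central pique -/

section Translations

variable {Q : Type u} [AddCommGroup Q] {A : PiqueStr Q} (he : A.e = 0)
  (hmul : ∀ x y z w : Q, A.mul (x + z) (y + w) = A.mul x y + A.mul z w)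

include he in
theorem mul_zero_zero : A.mul 0 0 = 0 := by rw [← he, A.idem]

include hmul in
theorem rdiv_add (x y z w : Q) : A.rdiv (x + z) (y + w) = A.rdiv x y + A.rdiv z w := by
  rw [A.mul_eq_iff_rdiv, hmul, A.sr, A.sr]

include hmul in
theorem ldiv_add (x y z w : Q) : A.ldiv (x + z) (y + w) = A.ldiv x y + A.ldiv z w := by
  rw [A.mul_eq_iff_ldiv, hmul, A.sl, A.sl]

include hmul in
theorem mul_eq_add (x y : Q) : A.mul x y = A.mul x 0 + A.mul 0 y := by
  rw [← hmul, add_zero, zero_add]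

/-- The endomorphisms by which `X₁, X₂, X₃` act: `x ↦ 0 \ x`, `x ↦ x · 0`, `x ↦ 0 / x`. -/
def translation (i : Fin 3) : AddMonoid.End Q :=
  AddMonoidHom.mk' (![A.ldiv 0, fun x => A.mul x 0, A.rdiv 0] i) (by
    intro x y
    fin_cases i
    · simpa using ldiv_add hmul 0 x 0 y
    · simpa using hmul x 0 y 0
    · simpa using rdiv_add hmul 0 x 0 y)

include he in
-- Since $x\cdot y=x\cdot0+0\cdot y$, the equation $(0/x)\cdot x=0$ reads $(0/x)\cdot0=-(0\cdot x)$,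
-- and $0\backslash$ undoes $0\cdot$. The other two relations come from the same splitting.
theorem translation_zero_one_two :
    translation hmul 0 * translation hmul 1 * translation hmul 2 = -1 := by
  ext x
  change A.ldiv 0 (A.mul (A.rdiv 0 x) 0) = -x
  rw [A.mul_eq_iff_ldiv]
  have h₁ := A.sr x 0
  rw [mul_eq_add hmul] at h₁
  have h₂ := hmul 0 x 0 (-x)
  rw [add_neg_cancel, add_zero, mul_zero_zero he] at h₂
  rw [eq_neg_of_add_eq_zero_left h₁, eq_neg_of_add_eq_zero_right h₂.symm]

include he in
theorem translation_two_zero_one :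
    translation hmul 2 * translation hmul 0 * translation hmul 1 = -1 := by
  ext x
  change A.rdiv 0 (A.ldiv 0 (A.mul x 0)) = -x
  rw [A.mul_eq_iff_rdiv, mul_eq_add hmul, A.sl, ← hmul, neg_add_cancel, add_zero,
    mul_zero_zero he]

theorem translation_one_two_zero :
    translation hmul 1 * translation hmul 2 * translation hmul 0 = -1 := by
  ext x
  change A.mul (A.rdiv 0 (A.ldiv 0 x)) 0 = -x
  have h₁ := A.sr (A.ldiv 0 x) 0
  rw [mul_eq_add hmul, A.sl] at h₁
  exact eq_neg_of_add_eq_zero_left h₁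

/-- The right action of `S` on a central pique. -/
noncomputable def actionHom : CoeffAlgᵐᵒᵖ →+* AddMonoid.End Q :=
  -- A right action composes in the order opposite to that of endomorphisms, so the lift lands in
  -- the opposite ring of `AddMonoid.End Q`; the relator $X_3X_2X_1$ becomes the composite of
  -- translations `0`, `1`, `2`.
  (RingEquiv.opOp (AddMonoid.End Q)).symm.toRingHom.comp <| RingHom.op <|
    CoeffAlg.lift (fun i => MulOpposite.op (translation hmul i))
      (MulOpposite.unop_injective <| (mul_assoc _ _ _).symm.trans
        (translation_zero_one_two he hmul))
      (MulOpposite.unop_injective <| (mul_assoc _ _ _).symm.trans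
        (translation_two_zero_one he hmul))
      (MulOpposite.unop_injective <| (mul_assoc _ _ _).symm.trans
        (translation_one_two_zero hmul))

theorem actionHom_gen (i : Fin 3) :
    actionHom he hmul (MulOpposite.op (gen i)) = translation hmul i :=
  congrArg MulOpposite.unop (CoeffAlg.lift_gen ..)

include he hmul in
theorem exists_module : ∃ _ : Module CoeffAlgᵐᵒᵖ Q, linStr Q = A := by
  let _ : Module CoeffAlgᵐᵒᵖ Q := Module.compHom Q (actionHom he hmul)
  refine ⟨inferInstance, PiqueStr.ext_mul (funext₂ fun x y => ?_) he.symm⟩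
  have h (i : Fin 3) (z : Q) : z <• gen i = translation hmul i z :=
    DFunLike.congr_fun (actionHom_gen he hmul i) z
  have h₁ (z : Q) : z <• (↑X₁⁻¹ : CoeffAlg) = A.mul 0 z := by
    have : A.mul 0 z <• (X₁ : CoeffAlg) = z := (h 0 _).trans (A.il 0 z)
    conv_lhs => rw [← this, act_act, Units.mul_inv]
    simp
  have h₂ (z : Q) : z <• (X₂ : CoeffAlg) = A.mul z 0 := h 1 z
  change x <• (X₂ : CoeffAlg) + y <• (↑X₁⁻¹ : CoeffAlg) = A.mul x y
  rw [h₁, h₂, ← mul_eq_add hmul]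

end Translations

/-! ### Linear maps and pique homomorphisms -/

section Linear

variable {M : Type u} [AddCommGroup M] [Module CoeffAlgᵐᵒᵖ M]

/-- Addition is the pique term $(x/e)\cdot(e\backslash y)$, so pique homomorphisms preserve it. -/
theorem linStr_add (x y : M) :
    (linStr M).mul ((linStr M).rdiv x (linStr M).e) ((linStr M).ldiv (linStr M).e y) = x + y := by
  simp [linStr, act_act]

theorem linStr_act_zero (x : M) : (linStr M).ldiv (linStr M).e x = x <• gen 0 := by
  change (0 : M) <• (↑X₃⁻¹ : CoeffAlg) + x <• (X₁ : CoeffAlg) = _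
  rw [smul_zero, zero_add]; rfl

theorem linStr_act_one (x : M) : (linStr M).mul x (linStr M).e = x <• gen 1 := by
  change x <• (X₂ : CoeffAlg) + (0 : M) <• (↑X₁⁻¹ : CoeffAlg) = _
  rw [smul_zero, add_zero]; rfl

theorem linStr_act_two (x : M) : (linStr M).rdiv (linStr M).e x = x <• gen 2 := by
  change (0 : M) <• (↑X₂⁻¹ : CoeffAlg) + x <• (X₃ : CoeffAlg) = _
  rw [smul_zero, zero_add]; rfl

theorem map_act_of_gen {N : Type u} [AddCommGroup N] [Module CoeffAlgᵐᵒᵖ N] (f : M →+ N)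
    (hf : ∀ i x, f (x <• gen i) = f x <• gen i) (s : CoeffAlg) (x : M) :
    f (x <• s) = f x <• s := by
  obtain ⟨a, rfl⟩ : ∃ a, CoeffAlg.mk a = s := RingQuot.mkRingHom_surjective CoeffRel s
  induction a using FreeAlgebra.induction generalizing x with
  | grade0 n =>
    have : CoeffAlg.mk (algebraMap ℤ _ n) = (n : CoeffAlg) := by simp
    rw [this, MulOpposite.op_intCast, Int.cast_smul_eq_zsmul, Int.cast_smul_eq_zsmul, map_zsmul]
  | grade1 i => exact hf i x
  | mul a b ha hb => rw [map_mul, ← act_act, ← act_act, hb, ha]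
  | add a b ha hb => rw [map_add, MulOpposite.op_add, add_smul, add_smul, map_add, ha, hb]

/-- A function that respects the pique operations is linear. -/
theorem linear_of_pique_hom {N : Type u} [AddCommGroup N] [Module CoeffAlgᵐᵒᵖ N] (f : M → N)
    (hmul : ∀ x y, f ((linStr M).mul x y) = (linStr N).mul (f x) (f y))
    (hrdiv : ∀ x y, f ((linStr M).rdiv x y) = (linStr N).rdiv (f x) (f y))
    (hldiv : ∀ x y, f ((linStr M).ldiv x y) = (linStr N).ldiv (f x) (f y))
    (he : f (linStr M).e = (linStr N).e) :
    (∀ x y, f (x + y) = f x + f y) ∧ ∀ (s : CoeffAlg) x, f (x <• s) = f x <• s := by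
  have hadd (x y : M) : f (x + y) = f x + f y := by
    rw [← linStr_add, hmul, hrdiv, hldiv, he, linStr_add]
  refine ⟨hadd, map_act_of_gen (AddMonoidHom.mk' f hadd) fun i x => ?_⟩
  change f (x <• gen i) = f x <• gen i
  fin_cases i
  · exact (congrArg f (linStr_act_zero x)).symm.trans
      ((hldiv _ _).trans ((congrArg₂ _ he rfl).trans (linStr_act_zero (f x))))
  · exact (congrArg f (linStr_act_one x)).symm.trans
      ((hmul _ _).trans ((congrArg₂ _ rfl he).trans (linStr_act_one (f x))))
  · exact (congrArg f (linStr_act_two x)).symm.trans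
      ((hrdiv _ _).trans ((congrArg₂ _ he rfl).trans (linStr_act_two (f x))))

end Linear

/-- A right `S`-module structure is determined by its pique. -/
theorem module_ext {M : Type u} {a b : AddCommGroup M}
    {m : @Module CoeffAlgᵐᵒᵖ M _ a.toAddCommMonoid}
    {n : @Module CoeffAlgᵐᵒᵖ M _ b.toAddCommMonoid}
    (h : @linStr M a m = @linStr M b n) : a = b ∧ HEq m n := by
  -- The identity map is a pique homomorphism between the two structures, hence linear, so sums and
  -- actions agree.
  have key := @linear_of_pique_hom M a m M b n id (fun _ _ => by rw [h]; rfl)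
    (fun _ _ => by rw [h]; rfl) (fun _ _ => by rw [h]; rfl) (by rw [h]; rfl)
  have hab : a = b := AddCommGroup.ext (funext₂ key.1)
  subst hab
  exact ⟨rfl, heq_of_eq (Module.ext' _ _ fun s x => key.2 s.unop x)⟩

/-! ### The equivalence and the bijection on objects -/

theorem linPique_obj_injective : Function.Injective linPique.{u}.obj := by
  rintro ⟨M, a, m⟩ ⟨N, b, n⟩ h
  obtain ⟨hMN, hstr⟩ := (CentralPique.mk.injEq ..).mp h
  change M = N at hMN
  subst hMN
  obtain ⟨rfl, hmn⟩ := module_ext (eq_of_heq hstr)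
  obtain rfl := eq_of_heq hmn
  rfl

theorem linPique_obj_surjective : Function.Surjective linPique.{u}.obj := by
  rintro ⟨Q, A, hA⟩
  obtain ⟨_, he, hmul⟩ := exists_addCommGroup hA
  obtain ⟨_, h⟩ := exists_module he hmul
  exact ⟨ModuleCat.of CoeffAlgᵐᵒᵖ Q, CentralPique.mk_congr h _ _⟩

instance : linPique.{u}.Faithful where
  map_injective h := by
    ext x
    exact congrFun (congrArg CentralPique.Hom.toFun h) x

instance : linPique.{u}.Full where
  map_surjective {M N} f := by
    have h := linear_of_pique_hom (M := M) (N := N) f.toFun f.map_mul f.map_rdiv f.map_ldiv f.map_e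
    exact ⟨ModuleCat.ofHom ⟨⟨f.toFun, h.1⟩, fun s x => h.2 s.unop x⟩, rfl⟩

instance : linPique.{u}.EssSurj where
  mem_essImage P := by
    obtain ⟨M, hM⟩ := linPique_obj_surjective P
    exact ⟨M, ⟨eqToIso hM⟩⟩

instance : linPique.{u}.IsEquivalence where

end CentralPiqueRep

theorem theorem6p2 :
    ∃ σ τ : RingAut CoeffAlg,
      -- (a) the two automorphisms and the group they generate
      (σ X₁ = ↑X₂⁻¹ ∧ σ X₂ = ↑X₁⁻¹ ∧ σ X₃ = ↑X₃⁻¹) ∧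
      (τ X₁ = ↑X₁⁻¹ ∧ τ X₂ = ↑X₃⁻¹ ∧ τ X₃ = ↑X₂⁻¹) ∧
      ∃ φ : Equiv.Perm (Fin 3) ≃* Subgroup.closure {σ, τ},
        ((φ (Equiv.swap 0 1) : RingAut CoeffAlg) = σ ∧
          (φ (Equiv.swap 1 2) : RingAut CoeffAlg) = τ) ∧
        -- (b) right modules are equivalent to central piques, over the same underlying sets
        (linPique.{u}.IsEquivalence ∧ Function.Bijective linPique.{u}.obj) ∧
        -- (c) triality is an action of the symmetric group on central piques,
        -- and it is induced by the action on the algebra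
        (CentralPique.triality.{u} 1 = 𝟭 CentralPique.{u} ∧
          ∀ g h : Equiv.Perm (Fin 3),
            CentralPique.triality.{u} g ⋙ CentralPique.triality.{u} h =
              CentralPique.triality.{u} (g * h)) ∧
        (∀ g : Equiv.Perm (Fin 3),
          twist.{u} (φ g) ⋙ linPique.{u} = linPique.{u} ⋙ CentralPique.triality.{u} g) ∧
        (∀ (g : Equiv.Perm (Fin 3)) (M : ModuleCat.{u} CoeffAlgᵐᵒᵖ) (x y : M),
          (linPique.{u}.obj M).str.conjOp g x y =
            x <• (φ g : RingAut CoeffAlg) (X₂ : CoeffAlg) +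
              y <• (φ g : RingAut CoeffAlg) (↑X₁⁻¹ : CoeffAlg)) := by
  have hX (g : Equiv.Perm (Fin 3)) :
      permAut g X₁ = permUnit g 0 ∧ permAut g X₂ = permUnit g 1 ∧ permAut g X₃ = permUnit g 2 :=
    ⟨permAut_genUnit g 0, permAut_genUnit g 1, permAut_genUnit g 2⟩
  refine ⟨permAut (Equiv.swap 0 1), permAut (Equiv.swap 1 2), ?_, ?_, permAutEquiv, ⟨rfl, rfl⟩,
    ⟨inferInstance, linPique_obj_injective, linPique_obj_surjective⟩,
    ⟨CentralPique.triality_one, CentralPique.triality_comp⟩, twist_comp_linPique,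
    fun g M x y => linStr_conjOp M g x y⟩
  · obtain ⟨h₁, h₂, h₃⟩ := hX (Equiv.swap 0 1)
    rw [h₁, h₂, h₃]
    simp [permUnit, genUnit, Equiv.swap_apply_of_ne_of_ne]
  · obtain ⟨h₁, h₂, h₃⟩ := hX (Equiv.swap 1 2)
    rw [h₁, h₂, h₃]
    simp [permUnit, genUnit, Equiv.swap_apply_of_ne_of_ne]
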